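/- All vector spaces are real. A vector lattice $E$ is Dedekind complete when every non-empty subset of $E$ that is bounded from above has a supremum. A net $(x_\alpha)$ in $E$ is order convergent to $x$ when there is a net $(y_\beta)$ in $E$ (possibly with another index set) with $y_\beta\downarrow 0$ such that for every $\beta_0$ there is an $\alpha_0$ with $|x-x_\alpha|\le y_{\beta_0}$ for all $\alpha\ge\alpha_0$; it is unbounded order (uo) convergent to $x$ when $|x_\alpha-x|\wedge y$ is order convergent to $0$ for every $y\ge 0$ in $E$. A linear operator on $E$ is order bounded when it maps order bounded sets to order bounded sets; for Dedekind complete $E$ the order bounded linear operators on $E$ form a vector lattice $\mathcal L_{\mathrm{ob}}(E)$, where $S\le T$ means $Sx\le Tx$ for all $x\ge 0$. A net $(S_\alpha)$ in $\mathcal L_{\mathrm{ob}}(E)$ is strongly unbounded order (SUO) convergent to $S\in\mathcal L_{\mathrm{ob}}(E)$ when $S_\alpha x$ is uo convergent to $Sx$ in $E$ for every $x\in E$. An orthomorphism on $E$ is an order bounded linear operator that maps every band of $E$ into itself, where a band is an order ideal that contains the supremum, whenever it exists in $E$, of each of its subsets. A linear operator on $E$ is order continuous when it maps nets that are order convergent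 to $0$ to nets that are order convergent to $0$; such an operator is order bounded. For $T\in\mathcal L_{\mathrm{ob}}(E)$, the maps $\rho_T,\lambda_T:\mathcal L_{\mathrm{ob}}(E)\to\mathcal L_{\mathrm{ob}}(E)$ are defined by $\rho_T(S)=ST$ and $\lambda_T(S)=TS$. A map is uo-uo continuous (resp. SUO-SUO continuous) when it maps every net that is uo (resp. SUO) convergent to some $S$ to a net that is uo (resp. SUO) convergent to the image of $S$. **Proposition.** Let $E$ be a Dedekind complete vector lattice. Then: 1. $\rho_T$ is uo-uo continuous on $\mathcal L_{\mathrm{ob}}(E)$ for every orthomorphism $T$ on $E$; 2. $\lambda_T$ is uo-uo continuous on $\mathcal L_{\mathrm{ob}}(E)$ for every orthomorphism $T$ on $E$; 3. $\rho_T$ is SUO-SUO continuous on $\mathcal L_{\mathrm{ob}}(E)$ for every $T\in\mathcal L_{\mathrm{ob}}(E)$; 4. $\lambda_T$ is SUO-SUO continuous on $\mathcal L_{\mathrm{ob}}(E)$ for every orthomorphism $T$ on $E$. In the parts 1, 2, and 4, "orthomorphism" cannot be weakened to "order continuous linear operator": there exist a Dedekind complete vector lattice $E$ and an order continuous linear operator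 $T$ on $E$ such that $\rho_T$ is not uo-uo continuous, $\lambda_T$ is not uo-uo continuous, and $\lambda_T$ is not SUO-SUO continuous on $\mathcal L_{\mathrm{ob}}(E)$. -/

import Mathlib

/-- A partially ordered set is Dedekind complete when every non-empty subset that is bounded
from above has a least upper bound. A vector lattice is expressed below by the instances
`[AddCommGroup E] [Lattice E] [IsOrderedAddMonoid E] [Module ℝ E] [IsOrderedModule ℝ E]`;
a Dedekind complete vector lattice is automatically Archimedean. -/
class DedekindComplete (E : Type*) [Preorder E] : Prop where
  exists_isLUB : ∀ s : Set E, s.Nonempty → BddAbove s → ∃ x, IsLUB s x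

/-! ### Convergence of nets -/

/-- A relation between nets in `X` (indexed by types in the universe `v`) and points of `X`.
It is only ever evaluated at non-empty directed index sets. -/
abbrev NetConvergence.{v, u} (X : Type u) :=
  ∀ (ι : Type v) [Preorder ι], (ι → X) → X → Prop

/-- A map is `C`-`D` continuous when it maps every net that is `C`-convergent to `x₀` to a net
that is `D`-convergent to the image of `x₀`. -/
def ContinuousWrt.{v, u, w} {X : Type u} {Y : Type w} (C : NetConvergence.{v} X)
    (D : NetConvergence.{v} Y) (Φ : X → Y) : Prop :=
  ∀ (ι : Type v) [Preorder ι] [IsDirectedOrder ι] [Nonempty ι] (x : ι → X) (x₀ : X),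
    C ι x x₀ → D ι (fun i => Φ (x i)) (Φ x₀)

/-- Order convergence: there is a net `y`, with a possibly different index set, such that
`y ↓ 0` and such that every `y b` eventually dominates `|x₀ - x a|`. -/
def OConv.{v, u} {E : Type u} [AddCommGroup E] [Lattice E] : NetConvergence.{v} E :=
  fun ι _ x x₀ =>
    ∃ (B : Type u) (_ : Preorder B) (_ : IsDirectedOrder B) (_ : Nonempty B) (y : B → E),
      Antitone y ∧ IsGLB (Set.range y) 0 ∧
        ∀ b₀ : B, ∃ a₀ : ι, ∀ a : ι, a₀ ≤ a → |x₀ - x a| ≤ y b₀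

/-- Unbounded order convergence: `|x a - x₀| ⊓ y` is order convergent to `0` for all `y ≥ 0`. -/
def UOConv.{v, u} {E : Type u} [AddCommGroup E] [Lattice E] : NetConvergence.{v} E :=
  fun ι _ x x₀ => ∀ y : E, 0 ≤ y → OConv ι (fun a => |x a - x₀| ⊓ y) 0

/-! ### Order bounded operators -/

section Operators

variable (E : Type*) [AddCommGroup E] [Lattice E] [IsOrderedAddMonoid E] [Module ℝ E]
  [IsOrderedModule ℝ E]

/-- The linear operators on `E` that map order bounded sets to order bounded sets, as a
subalgebra of the algebra of all linear operators (with composition as multiplication). -/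
def orderBoundedSubalgebra : Subalgebra ℝ (Module.End ℝ E) where
  carrier := {T | ∀ s : Set E, BddBelow s → BddAbove s → BddBelow (T '' s) ∧ BddAbove (T '' s)}
  mul_mem' := by
    intro S T hS hT s hb ha
    obtain ⟨h1, h2⟩ := hT s hb ha
    have := hS _ h1 h2
    rwa [Set.image_image] at this
  add_mem' := by
    intro S T hS hT s hb ha
    obtain ⟨⟨a, h1⟩, ⟨b, h2⟩⟩ := hT s hb ha
    obtain ⟨⟨c, h3⟩, ⟨d, h4⟩⟩ := hS s hb ha
    refine ⟨⟨c + a, ?_⟩, ⟨d + b, ?_⟩⟩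
    · rintro _ ⟨x, hx, rfl⟩
      exact add_le_add (h3 ⟨x, hx, rfl⟩) (h1 ⟨x, hx, rfl⟩)
    · rintro _ ⟨x, hx, rfl⟩
      exact add_le_add (h4 ⟨x, hx, rfl⟩) (h2 ⟨x, hx, rfl⟩)
  algebraMap_mem' := by
    rintro r s ⟨a, ha⟩ ⟨b, hb⟩
    rcases le_total 0 r with hr | hr
    · refine ⟨⟨r • a, ?_⟩, ⟨r • b, ?_⟩⟩
      · rintro _ ⟨x, hx, rfl⟩
        exact smul_le_smul_of_nonneg_left (ha hx) hr
      · rintro _ ⟨x, hx, rfl⟩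
        exact smul_le_smul_of_nonneg_left (hb hx) hr
    · refine ⟨⟨r • b, ?_⟩, ⟨r • a, ?_⟩⟩
      · rintro _ ⟨x, hx, rfl⟩
        exact smul_le_smul_of_nonpos_left (hb hx) hr
      · rintro _ ⟨x, hx, rfl⟩
        exact smul_le_smul_of_nonpos_left (ha hx) hr

/-- The order bounded linear operators on `E`. -/
def Lob : Type _ := orderBoundedSubalgebra E

namespace Lob

noncomputable instance : Ring (Lob E) := inferInstanceAs (Ring (orderBoundedSubalgebra E))

noncomputable instance : Algebra ℝ (Lob E) :=
  inferInstanceAs (Algebra ℝ (orderBoundedSubalgebra E))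

variable {E}

/-- The linear map underlying an order bounded operator. -/
def toLin (T : Lob E) : E →ₗ[ℝ] E := T.1

instance : CoeFun (Lob E) (fun _ => E → E) := ⟨fun T => T.toLin⟩

theorem bdd (T : Lob E) (s : Set E) (h₁ : BddBelow s) (h₂ : BddAbove s) :
    BddBelow (T '' s) ∧ BddAbove (T '' s) := T.2 s h₁ h₂

theorem ext {S T : Lob E} (h : ∀ x, S x = T x) : S = T := Subtype.ext (LinearMap.ext h)

@[simp] theorem add_apply (S T : Lob E) (x : E) : (S + T) x = S x + T x := rfl

@[simp] theorem neg_apply (S : Lob E) (x : E) : (-S) x = -S x := rfl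

@[simp] theorem sub_apply (S T : Lob E) (x : E) : (S - T) x = S x - T x := rfl

@[simp] theorem zero_apply (x : E) : (0 : Lob E) x = 0 := rfl

@[simp] theorem smul_apply (r : ℝ) (S : Lob E) (x : E) : (r • S) x = r • S x := rfl

@[simp] theorem mul_apply (S T : Lob E) (x : E) : (S * T) x = S (T x) := rfl

/-- `S ≤ T` means that `S x ≤ T x` for all `x ≥ 0`. -/
instance : PartialOrder (Lob E) where
  le S T := ∀ x : E, 0 ≤ x → S x ≤ T x
  le_refl _ _ _ := le_rfl
  le_trans _ _ _ h₁ h₂ x hx := (h₁ x hx).trans (h₂ x hx)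
  le_antisymm S T h₁ h₂ := by
    refine ext fun x => ?_
    have h : ∀ y : E, 0 ≤ y → S y = T y := fun y hy => le_antisymm (h₁ y hy) (h₂ y hy)
    rw [← posPart_sub_negPart x, map_sub, map_sub, h _ (posPart_nonneg x),
      h _ (negPart_nonneg x)]

theorem le_def {S T : Lob E} : S ≤ T ↔ ∀ x : E, 0 ≤ x → S x ≤ T x := Iff.rfl

instance : IsOrderedAddMonoid (Lob E) where
  add_le_add_left S T h R x hx := by
    simpa using h x hx

instance : IsOrderedModule ℝ (Lob E) where
  smul_le_smul_of_nonneg_left _ hr _ _ h x hx := smul_le_smul_of_nonneg_left (h x hx) hr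
  smul_le_smul_of_nonneg_right _ hS _ _ h x hx := smul_le_smul_of_nonneg_right h (hS x hx)

/-! The Riesz-Kantorovich theorem: if `E` is Dedekind complete, then every order bounded operator
has a positive part, so that the order bounded operators form a vector lattice. -/

theorem exists_isLUB_image [DedekindComplete E] (T : Lob E) {x : E} (hx : 0 ≤ x) :
    ∃ z, IsLUB (T '' Set.Icc 0 x) z :=
  DedekindComplete.exists_isLUB _ ⟨T 0, 0, ⟨le_rfl, hx⟩, rfl⟩
    (T.bdd _ bddBelow_Icc bddAbove_Icc).2

open Classical in
/-- The positive part of `T` at `x ≥ 0`, namely `sup {T y : 0 ≤ y ≤ x}`. -/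
noncomputable def posCone [DedekindComplete E] (T : Lob E) (x : E) : E :=
  if hx : 0 ≤ x then Classical.choose (T.exists_isLUB_image hx) else 0

theorem posCone_isLUB [DedekindComplete E] (T : Lob E) {x : E} (hx : 0 ≤ x) :
    IsLUB (T '' Set.Icc 0 x) (T.posCone x) := by
  rw [posCone, dif_pos hx]
  exact Classical.choose_spec (T.exists_isLUB_image hx)

theorem posCone_nonneg [DedekindComplete E] (T : Lob E) {x : E} (hx : 0 ≤ x) :
    0 ≤ T.posCone x :=
  (T.posCone_isLUB hx).1 ⟨0, ⟨le_rfl, hx⟩, map_zero _⟩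

theorem posCone_add [DedekindComplete E] (T : Lob E) {x y : E} (hx : 0 ≤ x) (hy : 0 ≤ y) :
    T.posCone (x + y) = T.posCone x + T.posCone y := by
  refine (T.posCone_isLUB (add_nonneg hx hy)).unique ?_
  constructor
  · rintro _ ⟨z, ⟨hz0, hz⟩, rfl⟩
    have h1 : T (z ⊓ x) ≤ T.posCone x :=
      (T.posCone_isLUB hx).1 ⟨_, ⟨le_inf hz0 hx, inf_le_right⟩, rfl⟩
    have h2 : T (z - z ⊓ x) ≤ T.posCone y := by
      refine (T.posCone_isLUB hy).1 ⟨_, ⟨sub_nonneg.2 inf_le_left, ?_⟩, rfl⟩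
      rw [sub_le_iff_le_add, ← sub_le_iff_le_add']
      exact le_inf (sub_le_self _ hy) (sub_le_iff_le_add.2 hz)
    have h3 := add_le_add h1 h2
    rwa [← map_add, add_sub_cancel] at h3
  · intro b hb
    rw [← le_sub_iff_add_le]
    refine (T.posCone_isLUB hx).2 ?_
    rintro _ ⟨u, ⟨hu0, hu⟩, rfl⟩
    rw [le_sub_comm]
    refine (T.posCone_isLUB hy).2 ?_
    rintro _ ⟨w, ⟨hw0, hw⟩, rfl⟩
    rw [le_sub_iff_add_le, ← map_add]
    exact hb ⟨_, ⟨add_nonneg hw0 hu0, by rw [add_comm]; exact add_le_add hu hw⟩, rfl⟩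

theorem posCone_smul_le [DedekindComplete E] (T : Lob E) {x : E} (hx : 0 ≤ x) {r : ℝ}
    (hr : 0 < r) : T.posCone (r • x) ≤ r • T.posCone x := by
  refine (T.posCone_isLUB (smul_nonneg hr.le hx)).2 ?_
  rintro _ ⟨z, ⟨hz0, hz⟩, rfl⟩
  have h : T (r⁻¹ • z) ≤ T.posCone x := by
    refine (T.posCone_isLUB hx).1 ⟨_, ⟨smul_nonneg (inv_nonneg.2 hr.le) hz0, ?_⟩, rfl⟩
    have := smul_le_smul_of_nonneg_left hz (inv_nonneg.2 hr.le)
    rwa [inv_smul_smul₀ hr.ne'] at this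
  have := smul_le_smul_of_nonneg_left h hr.le
  rwa [← map_smul, smul_inv_smul₀ hr.ne'] at this

theorem posCone_smul [DedekindComplete E] (T : Lob E) {x : E} (hx : 0 ≤ x) {r : ℝ}
    (hr : 0 < r) : T.posCone (r • x) = r • T.posCone x := by
  refine le_antisymm (T.posCone_smul_le hx hr) ?_
  have h := T.posCone_smul_le (smul_nonneg hr.le hx) (inv_pos.2 hr)
  rw [inv_smul_smul₀ hr.ne'] at h
  have := smul_le_smul_of_nonneg_left h hr.le
  rwa [smul_inv_smul₀ hr.ne'] at this

theorem posCone_sub_eq [DedekindComplete E] (T : Lob E) {a b c d : E} (ha : 0 ≤ a) (hb : 0 ≤ b)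
    (hc : 0 ≤ c) (hd : 0 ≤ d) (h : a - b = c - d) :
    T.posCone a - T.posCone b = T.posCone c - T.posCone d := by
  rw [sub_eq_sub_iff_add_eq_add] at h ⊢
  rw [← T.posCone_add ha hd, ← T.posCone_add hc hb, h]

/-- The positive part of `T` as a linear map. -/
noncomputable def posLin [DedekindComplete E] (T : Lob E) : E →ₗ[ℝ] E where
  toFun x := T.posCone x⁺ - T.posCone x⁻
  map_add' x y := by
    have hx := posPart_nonneg x
    have hy := posPart_nonneg y
    have hx' := negPart_nonneg x
    have hy' := negPart_nonneg y
    have h := T.posCone_sub_eq (posPart_nonneg (x + y)) (negPart_nonneg (x + y))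
      (add_nonneg hx hy) (add_nonneg hx' hy') (by
        rw [add_sub_add_comm, posPart_sub_negPart, posPart_sub_negPart, posPart_sub_negPart])
    rw [h, T.posCone_add hx hy, T.posCone_add hx' hy', add_sub_add_comm]
  map_smul' r x := by
    have hx := posPart_nonneg x
    have hx' := negPart_nonneg x
    simp only [RingHom.id_apply]
    rcases lt_trichotomy r 0 with hr | rfl | hr
    · have hr' : 0 < -r := neg_pos.2 hr
      have h := T.posCone_sub_eq (posPart_nonneg (r • x)) (negPart_nonneg (r • x))
        (smul_nonneg hr'.le hx') (smul_nonneg hr'.le hx) (by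
          rw [posPart_sub_negPart, ← smul_sub, neg_smul, ← smul_neg, neg_sub,
            posPart_sub_negPart])
      rw [h, T.posCone_smul hx hr', T.posCone_smul hx' hr', ← smul_sub, neg_smul, ← smul_neg,
        neg_sub]
    · simp
    · have h := T.posCone_sub_eq (posPart_nonneg (r • x)) (negPart_nonneg (r • x))
        (smul_nonneg hr.le hx) (smul_nonneg hr.le hx') (by
          rw [posPart_sub_negPart, ← smul_sub, posPart_sub_negPart])
      rw [h, T.posCone_smul hx hr, T.posCone_smul hx' hr, ← smul_sub]

theorem posLin_apply [DedekindComplete E] (T : Lob E) {x : E} (hx : 0 ≤ x) :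
    T.posLin x = T.posCone x := by
  have h := T.posCone_sub_eq (posPart_nonneg x) (negPart_nonneg x) hx le_rfl (by
    rw [posPart_sub_negPart, sub_zero])
  have h0 : T.posCone 0 = 0 := by
    have := T.posCone_add (le_refl (0 : E)) le_rfl
    rw [add_zero] at this
    simpa using this
  change T.posCone x⁺ - T.posCone x⁻ = T.posCone x
  rw [h, h0, sub_zero]

/-- The positive part of `T` as an order bounded operator. -/
noncomputable def pos [DedekindComplete E] (T : Lob E) : Lob E :=
  ⟨T.posLin, by
    have hmono : ∀ a b : E, a ≤ b → T.posLin a ≤ T.posLin b := by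
      intro a b hab
      have h := T.posCone_nonneg (sub_nonneg.2 hab)
      rwa [← T.posLin_apply (sub_nonneg.2 hab), map_sub, sub_nonneg] at h
    rintro s ⟨a, ha⟩ ⟨b, hb⟩
    refine ⟨⟨T.posLin a, ?_⟩, ⟨T.posLin b, ?_⟩⟩
    · rintro _ ⟨x, hx, rfl⟩
      exact hmono _ _ (ha hx)
    · rintro _ ⟨x, hx, rfl⟩
      exact hmono _ _ (hb hx)⟩

theorem pos_apply_isLUB [DedekindComplete E] (T : Lob E) {x : E} (hx : 0 ≤ x) :
    IsLUB (T '' Set.Icc 0 x) (T.pos x) := by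
  change IsLUB _ (T.posLin x)
  rw [T.posLin_apply hx]
  exact T.posCone_isLUB hx

theorem pos_isLUB [DedekindComplete E] (T : Lob E) : IsLUB {T, 0} T.pos := by
  constructor
  · rintro R (rfl | rfl) x hx
    · exact (pos_apply_isLUB _ hx).1 ⟨x, ⟨hx, le_rfl⟩, rfl⟩
    · exact (pos_apply_isLUB _ hx).1 ⟨0, ⟨le_rfl, hx⟩, map_zero _⟩
  · intro R hR x hx
    have hT : T ≤ R := hR (Or.inl rfl)
    have h0 : 0 ≤ R := hR (Or.inr rfl)
    refine (pos_apply_isLUB _ hx).2 ?_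
    rintro _ ⟨y, ⟨hy0, hy⟩, rfl⟩
    refine (hT y hy0).trans ?_
    have := h0 (x - y) (sub_nonneg.2 hy)
    rwa [zero_apply, map_sub, sub_nonneg] at this

/-- The vector lattice structure; `S ⊔ T = S + (T - S)⁺`. -/
noncomputable instance [DedekindComplete E] : Lattice (Lob E) where
  sup S T := S + pos (T - S)
  le_sup_left S T := le_add_of_nonneg_right ((pos_isLUB (T - S)).1 (Or.inr rfl))
  le_sup_right S T := by
    rw [← sub_le_iff_le_add']
    exact (pos_isLUB (T - S)).1 (Or.inl rfl)
  sup_le S T R h₁ h₂ := by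
    rw [← le_sub_iff_add_le']
    refine (pos_isLUB (T - S)).2 ?_
    rintro _ (rfl | rfl)
    · exact sub_le_sub_right h₂ S
    · exact sub_nonneg.2 h₁
  inf S T := S - pos (S - T)
  inf_le_left S T := sub_le_self _ ((pos_isLUB (S - T)).1 (Or.inr rfl))
  inf_le_right S T := sub_le_comm.1 ((pos_isLUB (S - T)).1 (Or.inl rfl))
  le_inf R S T h₁ h₂ := by
    rw [le_sub_comm]
    refine (pos_isLUB (S - T)).2 ?_
    rintro _ (rfl | rfl)
    · exact sub_le_sub_left h₂ S
    · exact sub_nonneg.2 h₁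

/-- Right multiplication `S ↦ S T`. -/
noncomputable def rho (T : Lob E) : Lob E → Lob E := fun S => S * T

/-- Left multiplication `S ↦ T S`. -/
noncomputable def lam (T : Lob E) : Lob E → Lob E := fun S => T * S

end Lob

/-- Strong unbounded order convergence: pointwise unbounded order convergence. -/
def SUOConv.{v, u} {E : Type u} [AddCommGroup E] [Lattice E] [IsOrderedAddMonoid E] [Module ℝ E]
    [IsOrderedModule ℝ E] : NetConvergence.{v} (Lob E) :=
  fun ι _ S S₀ => ∀ x : E, UOConv ι (fun a => S a x) (S₀ x)

variable {E}

/-- A band: an ideal (solid linear subspace) that contains the supremum, whenever it exists in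
`E`, of each of its subsets. -/
structure IsBand (B : Submodule ℝ E) : Prop where
  solid : ∀ x y : E, y ∈ B → |x| ≤ |y| → x ∈ B
  isLUB_mem : ∀ (s : Set E) (x : E), s ⊆ B → IsLUB s x → x ∈ B

/-- An orthomorphism: an order bounded operator that maps every band into itself. -/
def IsOrthomorphism (T : Lob E) : Prop :=
  ∀ B : Submodule ℝ E, IsBand B → ∀ x ∈ B, T x ∈ B

end Operators

/-- Order continuity: order null nets are mapped to order null nets. Quantifying over the nets
that are indexed by types in the universe of `E` is the same as quantifying over all nets, as an
order null net may be compared with the net of all pairs `(b, e)` with `|e| ≤ y b`, where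
`y ↓ 0` is a dominating net in `E`. -/
def IsOrderContinuous.{u} {E : Type u} [AddCommGroup E] [Lattice E] [IsOrderedAddMonoid E]
    [Module ℝ E] [IsOrderedModule ℝ E] (T : Lob E) : Prop :=
  ∀ (ι : Type u) [Preorder ι] [IsDirectedOrder ι] [Nonempty ι] (x : ι → E),
    OConv ι x 0 → OConv ι (fun a => T (x a)) 0

universe u v

set_option linter.unusedSectionVars false

/-! ### Order convergence and disjointness in vector lattices -/

section General

variable {V : Type*} [AddCommGroup V] [Lattice V] [IsOrderedAddMonoid V]

/-! The positive results rest on one inequality. If M is positive and preserves disjointness from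
each fixed element, then M x ⊓ y ≤ (r • x) ⊓ y + r⁻¹ • M y for x, y ≥ 0 and r > 0
(`IsPosBandPreserving.apply_inf_le_smul`). For r ≥ 1 the first term is at most r • (x ⊓ y). Letting
the net run and then r → ∞ shows that, in an Archimedean vector lattice, every linear map dominated
by such an M is uo-uo continuous (`IsPosBandPreserving.continuousWrt_uoConv`).

An orthomorphism is a difference of two such operators, which settles λ for SUO convergence by
evaluating at points. For uo convergence the criterion is applied in `Lob E` itself: by the
Riesz-Kantorovich formula and the same inequality, left and right multiplication by such an operator
are again positive and band preserving (`mulLeft`, `mulRight`). For ρ and SUO convergence nothing is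
needed beyond (S T) x = S (T x).

For the counterexample, let T send (x, y) in c₀₀ × ℝ^ℕ to the constant sequence ∑ x in the second
factor. Every e n has sum 1, and every coordinate of a constant sequence is the same. Hence T
composed with the null sequence `toUnit`, and the null sequence `ofCoord` composed with T, are
constant and nonzero. T is order continuous because a decreasing net in c₀₀ eventually lives on a
fixed finite set. -/

/-- The family `g` need be neither monotone nor directed: all eventual upper bounds, in reverse
order, form a directed index set, since the infimum of two of them is another one. This index set
also lives in the universe of `V`, as `OConv` demands. -/
theorem oConv_of_forall_le.{t, s} {V : Type s} [AddCommGroup V] [Lattice V]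
    [IsOrderedAddMonoid V] {ι : Type t} [Preorder ι] [IsDirectedOrder ι] [Nonempty ι]
    {κ : Type*} [Nonempty κ] {x : ι → V} {x₀ : V} (g : κ → V)
    (hg : ∀ k, ∃ a₀, ∀ a, a₀ ≤ a → |x₀ - x a| ≤ g k) (h : ∀ w, (∀ k, w ≤ g k) → w ≤ 0) :
    OConv.{t} ι x x₀ := by
  let G : Set V := {z | ∃ a₀, ∀ a, a₀ ≤ a → |x₀ - x a| ≤ z}
  refine ⟨(↥G)ᵒᵈ, inferInstance, ⟨?_⟩, ⟨OrderDual.toDual ⟨g (Classical.arbitrary κ), hg _⟩⟩,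
    fun z => (OrderDual.ofDual z).1, fun a b hab => hab, ⟨?_, ?_⟩, fun z => (OrderDual.ofDual z).2⟩
  · rintro ⟨a, a₀, ha⟩ ⟨b, b₀, hb⟩
    obtain ⟨c₀, hac, hbc⟩ := exists_ge_ge a₀ b₀
    exact ⟨OrderDual.toDual ⟨a ⊓ b, c₀, fun c hc =>
      le_inf (ha c (hac.trans hc)) (hb c (hbc.trans hc))⟩, inf_le_left, inf_le_right⟩
  · rintro _ ⟨⟨z, a₀, ha⟩, rfl⟩
    exact (abs_nonneg _).trans (ha a₀ le_rfl)
  · intro w hw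
    exact h w fun k => hw ⟨OrderDual.toDual ⟨g k, hg k⟩, rfl⟩

theorem inf_add_le_of_nonneg {p q y : V} (hp : 0 ≤ p) : (p + q) ⊓ y ≤ p + q ⊓ y := by
  rw [add_inf]
  exact inf_le_inf_left _ (le_add_of_nonneg_left hp)

theorem add_inf_eq_zero {a b y : V} (ha : 0 ≤ a) (hb : 0 ≤ b) (hy : 0 ≤ y) (h₁ : a ⊓ y = 0)
    (h₂ : b ⊓ y = 0) : (a + b) ⊓ y = 0 := by
  refine le_antisymm ?_ (le_inf (add_nonneg ha hb) hy)
  have h : (a + b) ⊓ y ≤ a := by simpa [h₂] using inf_add_le_of_nonneg (q := b) (y := y) ha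
  exact (le_inf h inf_le_right).trans h₁.le

theorem inf_eq_zero_of_le {a b y : V} (ha : 0 ≤ a) (hy : 0 ≤ y) (hab : a ≤ b) (h : b ⊓ y = 0) :
    a ⊓ y = 0 :=
  le_antisymm ((inf_le_inf_right _ hab).trans h.le) (le_inf ha hy)

theorem sub_inf_inf_sub_inf (a b : V) : (a - a ⊓ b) ⊓ (b - a ⊓ b) = 0 := by
  rw [← inf_sub, sub_self]

/-- The identity z = z ⊓ c + z ⊔ c - c bounds every z in `s` by w + x ⊔ c - c, so x obeys the same
bound; the identity for x turns this back into the claim. -/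
theorem IsLUB.inf_le_of_forall_inf_le {s : Set V} {x c w : V} (h : IsLUB s x)
    (hw : ∀ z ∈ s, z ⊓ c ≤ w) : x ⊓ c ≤ w := by
  have hx : x ≤ w + x ⊔ c - c := by
    refine h.2 fun z hz => ?_
    have h₁ := inf_add_sup z c
    rw [eq_sub_of_add_eq h₁.symm]
    gcongr
    · exact hw z hz
    · exact h.1 hz
  have h₂ := inf_add_sup x c
  rw [eq_sub_of_add_eq h₂]
  rw [le_sub_iff_add_le] at hx
  exact sub_le_iff_le_add.2 hx

/-! ### Archimedean order, disjoint complements and band preserving operators -/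

variable [Module ℝ V] [IsOrderedModule ℝ V]

theorem inf_smul_eq_zero {a y : V} (ha : 0 ≤ a) (hy : 0 ≤ y) (h : a ⊓ y = 0) {r : ℝ}
    (hr : 0 ≤ r) : (r • a) ⊓ y = 0 := by
  obtain ⟨n, hn⟩ := exists_nat_ge r
  refine inf_eq_zero_of_le (smul_nonneg hr ha) hy (smul_le_smul_of_nonneg_right hn ha) ?_
  clear hn
  induction n with
  | zero => simp [hy]
  | succ n ih =>
    push_cast
    rw [add_smul, one_smul]
    exact add_inf_eq_zero (smul_nonneg n.cast_nonneg ha) ha hy ih h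

theorem abs_smul_le (r : ℝ) (x : V) : |r • x| ≤ |r| • |x| := by
  rcases le_total 0 r with hr | hr
  · rw [abs_of_nonneg hr, abs_le']
    refine ⟨smul_le_smul_of_nonneg_left (le_abs_self x) hr, ?_⟩
    rw [← smul_neg]
    exact smul_le_smul_of_nonneg_left (neg_le_abs x) hr
  · have hr' : 0 ≤ -r := neg_nonneg.2 hr
    rw [abs_of_nonpos hr, abs_le']
    constructor
    · rw [← neg_smul_neg]
      exact smul_le_smul_of_nonneg_left (neg_le_abs x) hr'
    · rw [← neg_smul]
      exact smul_le_smul_of_nonneg_left (le_abs_self x) hr'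

variable (V) in
/-- The Archimedean property of an ordered vector space. -/
def HasArchimedeanOrder : Prop :=
  ∀ a w : V, (∀ n : ℕ, a ≤ ((n : ℝ) + 1)⁻¹ • w) → a ≤ 0

theorem DedekindComplete.hasArchimedeanOrder [DedekindComplete V] : HasArchimedeanOrder V := by
  intro a w h
  have h' : ∀ n : ℕ, ((n : ℝ) + 1) • a ≤ w := fun n => by
    have hn : (0 : ℝ) < (n : ℝ) + 1 := by positivity
    have := smul_le_smul_of_nonneg_left (h n) hn.le
    rwa [smul_inv_smul₀ hn.ne'] at this
  obtain ⟨s, hs⟩ := DedekindComplete.exists_isLUB (Set.range fun n : ℕ => ((n : ℝ) + 1) • a)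
    ⟨_, 0, rfl⟩ ⟨w, by rintro _ ⟨n, rfl⟩; exact h' n⟩
  -- Adding `a` to a member of the sequence gives the next member, so `s - a` is also an upper
  -- bound.
  have h₁ : s ≤ s - a := by
    refine hs.2 ?_
    rintro _ ⟨n, rfl⟩
    rw [le_sub_iff_add_le]
    refine le_of_eq_of_le ?_ (hs.1 ⟨n + 1, rfl⟩)
    push_cast
    module
  simpa using h₁

/-- The disjoint complement of an element `y ≥ 0`. -/
def disjointComplement {y : V} (hy : 0 ≤ y) : Submodule ℝ V where
  carrier := {z | |z| ⊓ y = 0}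
  zero_mem' := by simp [hy]
  add_mem' {a b} ha hb := inf_eq_zero_of_le (abs_nonneg _) hy (abs_add_le a b)
    (add_inf_eq_zero (abs_nonneg a) (abs_nonneg b) hy ha hb)
  smul_mem' r a ha := inf_eq_zero_of_le (abs_nonneg _) hy (abs_smul_le r a)
    (inf_smul_eq_zero (abs_nonneg a) hy ha (abs_nonneg r))

theorem mem_disjointComplement {y z : V} {hy : 0 ≤ y} :
    z ∈ disjointComplement hy ↔ |z| ⊓ y = 0 := Iff.rfl

theorem isBand_disjointComplement {y : V} (hy : 0 ≤ y) : IsBand (disjointComplement hy) where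
  solid x z hz hxz := inf_eq_zero_of_le (abs_nonneg x) hy hxz hz
  isLUB_mem s x hs hx := by
    rcases s.eq_empty_or_nonempty with rfl | ⟨z, hz⟩
    -- A supremum of the empty set is a least element, which in an ordered group can only be 0.
    · have hbot : ∀ w, x ≤ w := fun w => hx.2 (by simp)
      have h₀ : x = 0 := le_antisymm (hbot 0) (by simpa using hbot (x + x))
      rw [h₀]
      exact zero_mem _
    -- The positive part is handled by distributing ⊓ over the supremum; the negative part lies
    -- below |z| for any single z in `s`.
    · rw [mem_disjointComplement, ← posPart_add_negPart]
      refine add_inf_eq_zero (posPart_nonneg x) (negPart_nonneg x) hy ?_ ?_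
      · refine le_antisymm ?_ (le_inf (posPart_nonneg x) hy)
        have h₁ : x ⊓ y ≤ 0 := hx.inf_le_of_forall_inf_le fun w hw =>
          (inf_le_inf_right y (le_abs_self w)).trans (mem_disjointComplement.1 (hs hw)).le
        let := AddCommGroup.toDistribLattice V
        have h₂ : (x ⊔ 0) ⊓ y = x ⊓ y ⊔ 0 ⊓ y := inf_sup_right _ _ _
        rw [posPart_def, h₂]
        exact sup_le h₁ inf_le_left
      · refine inf_eq_zero_of_le (negPart_nonneg x) hy ?_ (hs hz)
        exact (negPart_anti (hx.1 hz)).trans (sup_le (neg_le_abs z) (abs_nonneg z))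

/-- A positive linear operator that preserves the disjoint complement of each element. -/
structure IsPosBandPreserving (M : V →ₗ[ℝ] V) : Prop where
  nonneg : ∀ x, 0 ≤ x → 0 ≤ M x
  inf_eq_zero : ∀ x y, 0 ≤ x → 0 ≤ y → x ⊓ y = 0 → M x ⊓ y = 0

namespace IsPosBandPreserving

variable {M : V →ₗ[ℝ] V}

theorem mono (hM : IsPosBandPreserving M) {x y : V} (h : x ≤ y) : M x ≤ M y := by
  simpa using hM.nonneg _ (sub_nonneg.2 h)

theorem smul (hM : IsPosBandPreserving M) {r : ℝ} (hr : 0 ≤ r) :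
    IsPosBandPreserving (r • M) where
  nonneg x hx := smul_nonneg hr (hM.nonneg x hx)
  inf_eq_zero x y hx hy h := inf_smul_eq_zero (hM.nonneg x hx) hy (hM.inf_eq_zero x y hx hy h) hr

theorem add (hM : IsPosBandPreserving M) {N : V →ₗ[ℝ] V} (hN : IsPosBandPreserving N) :
    IsPosBandPreserving (M + N) where
  nonneg x hx := add_nonneg (hM.nonneg x hx) (hN.nonneg x hx)
  inf_eq_zero x y hx hy h := add_inf_eq_zero (hM.nonneg x hx) (hN.nonneg x hx) hy
    (hM.inf_eq_zero x y hx hy h) (hN.inf_eq_zero x y hx hy h)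

/-- Split x as x ⊓ y plus a remainder. M maps the first part below M y. The remainder is disjoint
from y - x ⊓ y, hence so is its image, which therefore meets y in at most x ⊓ y. -/
theorem apply_inf_le (hM : IsPosBandPreserving M) {x y : V} (hx : 0 ≤ x) (hy : 0 ≤ y) :
    M x ⊓ y ≤ x ⊓ y + M y := by
  have hu : 0 ≤ x - x ⊓ y := sub_nonneg.2 inf_le_left
  have hd : 0 ≤ y - x ⊓ y := sub_nonneg.2 inf_le_right
  have h₀ : 0 ≤ x ⊓ y := le_inf hx hy
  have h₁ : M (x - x ⊓ y) ⊓ (y - x ⊓ y) = 0 :=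
    hM.inf_eq_zero _ _ hu hd (sub_inf_inf_sub_inf x y)
  have h₂ : M (x - x ⊓ y) ⊓ y ≤ x ⊓ y := by
    have := inf_add_le_of_nonneg (q := y - x ⊓ y) (y := M (x - x ⊓ y)) h₀
    rwa [add_sub_cancel, inf_comm, inf_comm (y - x ⊓ y), h₁, add_zero] at this
  have h₃ := inf_add_le_of_nonneg (q := M (x - x ⊓ y)) (y := y) (hM.nonneg _ h₀)
  rw [← map_add, add_sub_cancel] at h₃
  rw [add_comm]
  exact h₃.trans (add_le_add (hM.mono inf_le_right) h₂)

theorem apply_inf_le_smul (hM : IsPosBandPreserving M) {x y : V} (hx : 0 ≤ x) (hy : 0 ≤ y)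
    {r : ℝ} (hr : 0 < r) : M x ⊓ y ≤ (r • x) ⊓ y + r⁻¹ • M y := by
  -- Rescaling: r⁻¹ • M is applied to r • x.
  have h := (hM.smul (inv_nonneg.2 hr.le)).apply_inf_le (smul_nonneg hr.le hx) hy
  simpa [hr.ne'] using h

end IsPosBandPreserving

theorem smul_inf_le_smul_inf {x y : V} (hx : 0 ≤ x) (hy : 0 ≤ y) {r : ℝ} (hr : 1 ≤ r) :
    (r • x) ⊓ y ≤ r • (x ⊓ y) := by
  have hr₀ : 0 < r := zero_lt_one.trans_le hr
  have hw : 0 ≤ (r • x) ⊓ y := le_inf (smul_nonneg hr₀.le hx) hy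
  have h : r⁻¹ • ((r • x) ⊓ y) ≤ x ⊓ y := by
    refine le_inf ?_ ?_
    · have := smul_le_smul_of_nonneg_left (inf_le_left : (r • x) ⊓ y ≤ r • x) (inv_nonneg.2 hr₀.le)
      rwa [inv_smul_smul₀ hr₀.ne'] at this
    · refine le_trans ?_ (inf_le_right : (r • x) ⊓ y ≤ y)
      simpa using smul_le_smul_of_nonneg_right (inv_le_one_of_one_le₀ hr) hw
  have := smul_le_smul_of_nonneg_left h hr₀.le
  rwa [smul_inv_smul₀ hr₀.ne'] at this

/-- A linear operator that is dominated by a positive band preserving operator is continuous for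
unbounded order convergence. -/
theorem IsPosBandPreserving.continuousWrt_uoConv.{t, s} {V : Type s} [AddCommGroup V] [Lattice V]
    [IsOrderedAddMonoid V] [Module ℝ V] [IsOrderedModule ℝ V] (hV : HasArchimedeanOrder V)
    {M Φ : V →ₗ[ℝ] V} (hM : IsPosBandPreserving M) (hΦ : ∀ x, |Φ x| ≤ M |x|) :
    ContinuousWrt (UOConv.{t} (E := V)) (UOConv.{t} (E := V)) Φ := by
  intro ι _ _ _ x x₀ hx y hy
  obtain ⟨B, _, _, _, z, -, hz, hxz⟩ := hx y hy
  refine oConv_of_forall_le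
    (fun k : B × ℕ => ((k.2 : ℝ) + 1) • z k.1 + ((k.2 : ℝ) + 1)⁻¹ • M y) ?_ ?_
  · rintro ⟨b, n⟩
    obtain ⟨a₀, ha₀⟩ := hxz b
    refine ⟨a₀, fun a ha => ?_⟩
    have hn : (1 : ℝ) ≤ (n : ℝ) + 1 := by simp
    have h₁ := ha₀ a ha
    rw [zero_sub, abs_neg, abs_of_nonneg (le_inf (abs_nonneg _) hy)] at h₁ ⊢
    rw [← map_sub]
    calc |Φ (x a - x₀)| ⊓ y ≤ M |x a - x₀| ⊓ y := inf_le_inf_right _ (hΦ _)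
      _ ≤ (((n : ℝ) + 1) • |x a - x₀|) ⊓ y + ((n : ℝ) + 1)⁻¹ • M y :=
        hM.apply_inf_le_smul (abs_nonneg _) hy (zero_lt_one.trans_le hn)
      _ ≤ ((n : ℝ) + 1) • (|x a - x₀| ⊓ y) + ((n : ℝ) + 1)⁻¹ • M y := by
        gcongr
        exact smul_inf_le_smul_inf (abs_nonneg _) hy hn
      _ ≤ _ := by
        gcongr
  · intro w hw
    refine hV w (M y) fun n => ?_
    have hn : (0 : ℝ) < (n : ℝ) + 1 := by positivity
    -- For fixed n the infimum over the dominating net is taken first; the Archimedean property then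
    -- removes the M y term.
    have h : ((n : ℝ) + 1)⁻¹ • (w - ((n : ℝ) + 1)⁻¹ • M y) ≤ 0 := by
      refine hz.2 ?_
      rintro _ ⟨b, rfl⟩
      have := smul_le_smul_of_nonneg_left (sub_le_iff_le_add.2 (hw (b, n))) (inv_nonneg.2 hn.le)
      rwa [inv_smul_smul₀ hn.ne'] at this
    have := smul_le_smul_of_nonneg_left h hn.le
    rwa [smul_inv_smul₀ hn.ne', smul_zero, sub_nonpos] at this

end General

/-! ### Orthomorphisms -/

section Orthomorphisms

variable {E : Type*} [AddCommGroup E] [Lattice E] [IsOrderedAddMonoid E] [Module ℝ E]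
  [IsOrderedModule ℝ E]

theorem Lob.mono {T : Lob E} (hT : 0 ≤ T) {x y : E} (h : x ≤ y) : T x ≤ T y := by
  have := hT (y - x) (sub_nonneg.2 h)
  rwa [Lob.zero_apply, map_sub, sub_nonneg] at this

theorem Lob.mul_nonneg {S T : Lob E} (hS : 0 ≤ S) (hT : 0 ≤ T) : 0 ≤ S * T :=
  fun x hx => hS _ (hT x hx)

variable [DedekindComplete E]

/-- The order is pointwise on the positive cone, so the property passes from `E` to its operators
without any appeal to completeness of `Lob E`. -/
theorem Lob.hasArchimedeanOrder : HasArchimedeanOrder (Lob E) := fun _ W h x hx =>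
  DedekindComplete.hasArchimedeanOrder _ (W x) fun n => h n x hx

/-- The Riesz-Kantorovich formula for the infimum of two disjoint operators. -/
theorem Lob.le_zero_of_forall_le {S R : Lob E} (h : S ⊓ R = 0) {x w : E} (hx : 0 ≤ x)
    (hw : ∀ u, 0 ≤ u → u ≤ x → w ≤ S (x - u) + R u) : w ≤ 0 := by
  -- S ⊓ R is by definition S - (S - R)⁺, so disjointness says that S x is the supremum of (S - R) u
  -- over 0 ≤ u ≤ x.
  have h₁ : S = pos (S - R) := sub_eq_zero.1 h
  have h₂ : S x ≤ S x - w := by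
    have h₃ : S x - w ∈ upperBounds ((S - R) '' Set.Icc 0 x) := by
      rintro _ ⟨u, ⟨hu₀, hu⟩, rfl⟩
      have := hw u hu₀ hu
      rw [map_sub] at this
      rw [Lob.sub_apply, le_sub_iff_add_le, ← le_sub_iff_add_le']
      refine this.trans (le_of_eq ?_)
      abel
    have h₄ := (pos_apply_isLUB (S - R) hx).2 h₃
    rwa [← h₁] at h₄
  simpa using h₂

/-- Write Z x = Z (x - u) + Z u, bounding the first term by `hW` and the second by R u. With r = n +
1 this gives Z x ≤ r • (S (x - u) + R u) + r⁻¹ • W; the infimum over u removes the first summand,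
and n → ∞ the second. -/
theorem Lob.apply_le_zero_of_forall_le {S R Z : Lob E} (hR : 0 ≤ R) (h : S ⊓ R = 0)
    (hZ : Z ≤ R) {x : E} (hx : 0 ≤ x) (W : E)
    (hW : ∀ n : ℕ, ∀ v, 0 ≤ v → v ≤ x → Z v ≤ ((n : ℝ) + 1) • S v + ((n : ℝ) + 1)⁻¹ • W) :
    Z x ≤ 0 := by
  refine DedekindComplete.hasArchimedeanOrder _ W fun n => ?_
  have hn₁ : (1 : ℝ) ≤ (n : ℝ) + 1 := by simp
  have hn : (0 : ℝ) < (n : ℝ) + 1 := by positivity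
  have key : ((n : ℝ) + 1)⁻¹ • (Z x - ((n : ℝ) + 1)⁻¹ • W) ≤ 0 := by
    refine Lob.le_zero_of_forall_le h hx fun u hu₀ hu => ?_
    have h₁ := hW n (x - u) (sub_nonneg.2 hu) (sub_le_self x hu₀)
    have h₂ : Z u ≤ ((n : ℝ) + 1) • R u := by
      refine (hZ u hu₀).trans ?_
      simpa using smul_le_smul_of_nonneg_right hn₁ (hR u hu₀)
    have h₃ : Z x - ((n : ℝ) + 1)⁻¹ • W ≤ ((n : ℝ) + 1) • (S (x - u) + R u) := by
      have e : Z x = Z (x - u) + Z u := by rw [← map_add, sub_add_cancel]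
      rw [sub_le_iff_le_add, e]
      refine (add_le_add h₁ h₂).trans (le_of_eq ?_)
      module
    have := smul_le_smul_of_nonneg_left h₃ (inv_nonneg.2 hn.le)
    rwa [inv_smul_smul₀ hn.ne'] at this
  have := smul_le_smul_of_nonneg_left key hn.le
  rwa [smul_inv_smul₀ hn.ne', smul_zero, sub_nonpos] at this

/-! ### Multiplication by band preserving operators -/

namespace IsPosBandPreserving

theorem mulLeft {T : Lob E} (hT : IsPosBandPreserving T.toLin) :
    IsPosBandPreserving (LinearMap.mulLeft ℝ T) where
  nonneg S hS := Lob.mul_nonneg hT.nonneg hS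
  inf_eq_zero S R hS hR h := by
    rw [LinearMap.mulLeft_apply]
    have hZ : 0 ≤ T * S ⊓ R := le_inf (Lob.mul_nonneg hT.nonneg hS) hR
    refine le_antisymm (fun x hx => ?_) hZ
    have hZ₁ : T * S ⊓ R ≤ T * S := inf_le_left
    -- With Z = T * S ⊓ R, the value Z v lies below both T (S v) and the fixed element Z x, so the
    -- basic inequality applies to S v and Z x.
    refine Lob.apply_le_zero_of_forall_le hR h inf_le_right hx (T ((T * S ⊓ R) x))
      fun n v hv hvx => ?_
    refine (le_inf (hZ₁ v hv) (Lob.mono hZ hvx)).trans ?_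
    refine (hT.apply_inf_le_smul (hS v hv) (hZ x hx) (r := (n : ℝ) + 1) (by positivity)).trans ?_
    gcongr
    exact inf_le_left

theorem mulRight {T : Lob E} (hT : IsPosBandPreserving T.toLin) :
    IsPosBandPreserving (LinearMap.mulRight ℝ T) where
  nonneg S hS := Lob.mul_nonneg hS hT.nonneg
  inf_eq_zero S R hS hR h := by
    rw [LinearMap.mulRight_apply]
    have hZ : 0 ≤ S * T ⊓ R := le_inf (Lob.mul_nonneg hS hT.nonneg) hR
    refine le_antisymm (fun x hx => ?_) hZ
    have hZ₁ : S * T ⊓ R ≤ S * T := inf_le_left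
    -- Here the basic inequality is used inside the argument of S: T v = T v ⊓ T x is estimated
    -- first, and then S is applied.
    refine Lob.apply_le_zero_of_forall_le hR h inf_le_right hx (S (T (T x)))
      fun n v hv hvx => ?_
    have h₀ : T v ≤ ((n : ℝ) + 1) • v + ((n : ℝ) + 1)⁻¹ • T (T x) := by
      refine (le_inf le_rfl (hT.mono hvx)).trans ?_
      refine (hT.apply_inf_le_smul hv (hT.nonneg x hx) (r := (n : ℝ) + 1) (by positivity)).trans ?_
      gcongr
      exact inf_le_left
    refine (hZ₁ v hv).trans ((Lob.mono hS h₀).trans (le_of_eq ?_))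
    rw [map_add, map_smul, map_smul]

end IsPosBandPreserving

namespace IsOrthomorphism

/-- The disjoint complement of y is a band containing [0, x], so T maps [0, x] into it, and the
supremum T⁺ x of the image stays there. -/
theorem pos {T : Lob E} (hT : IsOrthomorphism T) : IsPosBandPreserving T.pos.toLin where
  nonneg x hx := (Lob.pos_isLUB T).1 (Or.inr rfl) x hx
  inf_eq_zero x y hx hy h := by
    have hmem : T.pos x ∈ disjointComplement hy := by
      refine (isBand_disjointComplement hy).isLUB_mem _ _ ?_ (Lob.pos_apply_isLUB T hx)
      rintro _ ⟨u, ⟨hu₀, hu⟩, rfl⟩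
      refine hT _ (isBand_disjointComplement hy) u ?_
      rw [mem_disjointComplement, abs_of_nonneg hu₀]
      exact inf_eq_zero_of_le hu₀ hy hu h
    rwa [mem_disjointComplement,
      abs_of_nonneg ((Lob.pos_isLUB T).1 (Or.inr rfl) x hx)] at hmem

theorem neg {T : Lob E} (hT : IsOrthomorphism T) : IsOrthomorphism (-T) :=
  fun B hB x hx => B.neg_mem (hT B hB x hx)

/-- Every orthomorphism is the difference of two positive band preserving operators. -/
theorem exists_eq_sub {T : Lob E} (hT : IsOrthomorphism T) :
    ∃ A B : Lob E, T = A - B ∧ IsPosBandPreserving A.toLin ∧ IsPosBandPreserving B.toLin := by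
  refine ⟨T.pos, (-T).pos, ?_, hT.pos, hT.neg.pos⟩
  have h₁ : T.pos = T⁺ := (Lob.pos_isLUB T).unique isLUB_pair
  have h₂ : (-T).pos = T⁻ := (Lob.pos_isLUB (-T)).unique isLUB_pair
  rw [h₁, h₂, posPart_sub_negPart]

end IsOrthomorphism

theorem abs_apply_le_of_nonneg {V : Type*} [AddCommGroup V] [Lattice V] [IsOrderedAddMonoid V]
    [Module ℝ V] [IsOrderedModule ℝ V] {M : V →ₗ[ℝ] V} (hM : IsPosBandPreserving M) (x : V) :
    |M x| ≤ M |x| := by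
  rw [abs_le', ← map_neg]
  exact ⟨hM.mono (le_abs_self x), hM.mono (neg_le_abs x)⟩

theorem abs_sub_apply_le {V : Type*} [AddCommGroup V] [Lattice V] [IsOrderedAddMonoid V]
    [Module ℝ V] [IsOrderedModule ℝ V] {A B : V →ₗ[ℝ] V} (hA : IsPosBandPreserving A)
    (hB : IsPosBandPreserving B) (x : V) : |(A - B) x| ≤ (A + B) |x| := by
  rw [LinearMap.sub_apply, LinearMap.add_apply, sub_eq_add_neg]
  refine (abs_add_le _ _).trans ?_
  rw [abs_neg]
  exact add_le_add (abs_apply_le_of_nonneg hA x) (abs_apply_le_of_nonneg hB x)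

namespace IsOrthomorphism

theorem continuousWrt_uoConv.{t, s} {E : Type s} [AddCommGroup E] [Lattice E]
    [IsOrderedAddMonoid E] [Module ℝ E] [IsOrderedModule ℝ E] [DedekindComplete E] {T : Lob E}
    (hT : IsOrthomorphism T) :
    ContinuousWrt (UOConv.{t} (E := E)) (UOConv.{t} (E := E)) T := by
  obtain ⟨A, B, rfl, hA, hB⟩ := hT.exists_eq_sub
  exact (hA.add hB).continuousWrt_uoConv DedekindComplete.hasArchimedeanOrder
    (abs_sub_apply_le hA hB)

theorem continuousWrt_lam.{t, s} {E : Type s} [AddCommGroup E] [Lattice E]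
    [IsOrderedAddMonoid E] [Module ℝ E] [IsOrderedModule ℝ E] [DedekindComplete E] {T : Lob E}
    (hT : IsOrthomorphism T) :
    ContinuousWrt (UOConv.{t} (E := Lob E)) (UOConv.{t} (E := Lob E)) (Lob.lam T) := by
  obtain ⟨A, B, rfl, hA, hB⟩ := hT.exists_eq_sub
  have h := (hA.mulLeft.add hB.mulLeft).continuousWrt_uoConv.{t} Lob.hasArchimedeanOrder
    (abs_sub_apply_le hA.mulLeft hB.mulLeft)
  convert h using 1
  exact funext fun S => sub_mul A B S

theorem continuousWrt_rho.{t, s} {E : Type s} [AddCommGroup E] [Lattice E]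
    [IsOrderedAddMonoid E] [Module ℝ E] [IsOrderedModule ℝ E] [DedekindComplete E] {T : Lob E}
    (hT : IsOrthomorphism T) :
    ContinuousWrt (UOConv.{t} (E := Lob E)) (UOConv.{t} (E := Lob E)) (Lob.rho T) := by
  obtain ⟨A, B, rfl, hA, hB⟩ := hT.exists_eq_sub
  have h := (hA.mulRight.add hB.mulRight).continuousWrt_uoConv.{t} Lob.hasArchimedeanOrder
    (abs_sub_apply_le hA.mulRight hB.mulRight)
  convert h using 1
  exact funext fun S => mul_sub S A B

end IsOrthomorphism

end Orthomorphisms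

/-! ### Tools for the counterexample -/

section General

variable {V : Type*} [AddCommGroup V] [Lattice V] [IsOrderedAddMonoid V]

theorem not_uoConv_const_zero.{t, s} {V : Type s} [AddCommGroup V] [Lattice V]
    [IsOrderedAddMonoid V] {ι : Type t} [Preorder ι] {k : V} (hk₀ : 0 ≤ k) (hk : k ≠ 0) :
    ¬ UOConv.{t} ι (fun _ => k) 0 := by
  intro h
  obtain ⟨B, _, _, _, y, -, hy, hky⟩ := h k hk₀
  refine hk (le_antisymm (hy.2 ?_) hk₀)
  rintro _ ⟨b, rfl⟩
  obtain ⟨a₀, ha₀⟩ := hky b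
  simpa [abs_of_nonneg hk₀] using ha₀ a₀ le_rfl

theorem uoConv_zero_of_forall_le.{t, s} {V : Type s} [AddCommGroup V] [Lattice V]
    [IsOrderedAddMonoid V] {ι : Type t} [Preorder ι] [IsDirectedOrder ι] [Nonempty ι]
    {x : ι → V} (hx : ∀ a, 0 ≤ x a) (g : V → ι → V)
    (hg : ∀ y, 0 ≤ y → ∀ b a, b ≤ a → x a ⊓ y ≤ g y b)
    (h : ∀ y, 0 ≤ y → ∀ w, (∀ b, w ≤ g y b) → w ≤ 0) : UOConv.{t} ι x 0 := by
  refine fun y hy => oConv_of_forall_le (g y) (fun b => ⟨b, fun a ha => ?_⟩) (h y hy)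
  rw [zero_sub, abs_neg, sub_zero, abs_of_nonneg (hx a), abs_of_nonneg (le_inf (hx a) hy)]
  exact hg y hy b a ha

variable [Module ℝ V] [IsOrderedModule ℝ V]

/-- A positive linear operator as an order bounded operator. -/
def Lob.ofNonneg (f : V →ₗ[ℝ] V) (hf : ∀ x, 0 ≤ x → 0 ≤ f x) : Lob V :=
  ⟨f, by
    have hmono : ∀ a b : V, a ≤ b → f a ≤ f b := fun a b hab => by
      simpa using hf _ (sub_nonneg.2 hab)
    rintro s ⟨a, ha⟩ ⟨b, hb⟩
    refine ⟨⟨f a, ?_⟩, ⟨f b, ?_⟩⟩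
    · rintro _ ⟨x, hx, rfl⟩
      exact hmono _ _ (ha hx)
    · rintro _ ⟨x, hx, rfl⟩
      exact hmono _ _ (hb hx)⟩

theorem Lob.ofNonneg_nonneg (f : V →ₗ[ℝ] V) (hf : ∀ x, 0 ≤ x → 0 ≤ f x) :
    0 ≤ Lob.ofNonneg f hf := hf

end General

/-! ### A vector lattice on which order continuity does not suffice -/

instance : DedekindComplete (ℕ → ℝ) where
  exists_isLUB s hs hb := by
    refine ⟨fun i => sSup (Function.eval i '' s), isLUB_pi.2 fun i => ?_⟩
    exact isLUB_csSup (hs.image _) (Monotone.map_bddAbove (Function.monotone_eval i) hb)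

instance : DedekindComplete (ℕ →₀ ℝ) where
  exists_isLUB s hs hb := by
    obtain ⟨f, hf⟩ := hs
    obtain ⟨b, hb⟩ := hb
    have hlub : ∀ i, IsLUB ((fun g : ℕ →₀ ℝ => g i) '' s) (sSup ((fun g : ℕ →₀ ℝ => g i) '' s)) :=
      fun i => isLUB_csSup ⟨_, f, hf, rfl⟩ ⟨b i, by rintro _ ⟨g, hg, rfl⟩; exact hb hg i⟩
    -- Off the supports of a member `f` and an upper bound `b`, the pointwise supremum is squeezed
    -- between 0 and 0, so it is finitely supported.
    refine ⟨Finsupp.onFinset (f.support ∪ b.support)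
      (fun i => sSup ((fun g : ℕ →₀ ℝ => g i) '' s)) fun i hi => ?_, ?_, ?_⟩
    · by_contra h
      simp only [Finset.mem_union, Finsupp.mem_support_iff, not_or, not_not] at h
      refine hi (le_antisymm ?_ ?_)
      · refine (hlub i).2 ?_
        rintro _ ⟨g, hg, rfl⟩
        exact (hb hg i).trans h.2.le
      · exact h.1.ge.trans ((hlub i).1 ⟨f, hf, rfl⟩)
    · intro g hg i
      exact (hlub i).1 ⟨g, hg, rfl⟩
    · intro u hu i
      refine (hlub i).2 ?_
      rintro _ ⟨g, hg, rfl⟩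
      exact hu hg i

instance {V W : Type*} [Preorder V] [Preorder W] [DedekindComplete V] [DedekindComplete W] :
    DedekindComplete (V × W) where
  exists_isLUB s hs hb := by
    obtain ⟨x, hx⟩ := DedekindComplete.exists_isLUB (Prod.fst '' s) (hs.image _)
      (monotone_fst.map_bddAbove hb)
    obtain ⟨y, hy⟩ := DedekindComplete.exists_isLUB (Prod.snd '' s) (hs.image _)
      (monotone_snd.map_bddAbove hb)
    exact ⟨(x, y), isLUB_prod.2 ⟨hx, hy⟩⟩

/-- The product of the finitely supported sequences and all sequences. -/
abbrev SumSeq : Type := (ℕ →₀ ℝ) × (ℕ → ℝ)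

namespace SumSeq

instance : IsOrderedModule ℝ SumSeq where
  smul_le_smul_of_nonneg_left _ hr _ _ h :=
    ⟨smul_le_smul_of_nonneg_left h.1 hr, smul_le_smul_of_nonneg_left h.2 hr⟩
  smul_le_smul_of_nonneg_right _ hx _ _ h :=
    ⟨smul_le_smul_of_nonneg_right h hx.1, smul_le_smul_of_nonneg_right h hx.2⟩

/-- The functional that sums a finitely supported sequence. -/
noncomputable def total : (ℕ →₀ ℝ) →ₗ[ℝ] ℝ := Finsupp.linearCombination ℝ fun _ => 1

theorem total_apply (f : ℕ →₀ ℝ) : total f = f.sum fun _ r => r := by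
  simp [total, Finsupp.linearCombination_apply]

theorem total_nonneg {f : ℕ →₀ ℝ} (hf : 0 ≤ f) : 0 ≤ total f := by
  rw [total_apply]
  exact Finsupp.sum_nonneg' hf

/-- The operator `(x, y) ↦ (0, (∑ x) 1)`. -/
noncomputable def sumOp : Lob SumSeq :=
  Lob.ofNonneg
    { toFun := fun x => (0, fun _ => total x.1)
      map_add' := fun x y => by ext <;> simp
      map_smul' := fun r x => by ext <;> simp }
    fun x hx => ⟨le_rfl, fun _ => total_nonneg hx.1⟩

/-- The operator `(x, y) ↦ (y 0 e n, 0)`. -/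
noncomputable def toUnit (n : ℕ) : Lob SumSeq :=
  Lob.ofNonneg
    { toFun := fun x => (Finsupp.single n (x.2 0), 0)
      map_add' := fun x y => by ext <;> simp
      map_smul' := fun r x => by ext <;> simp }
    fun x hx => ⟨Finsupp.single_nonneg.2 (hx.2 0), le_rfl⟩

/-- The operator `(x, y) ↦ (y n e 0, 0)`. -/
noncomputable def ofCoord (n : ℕ) : Lob SumSeq :=
  Lob.ofNonneg
    { toFun := fun x => (Finsupp.single 0 (x.2 n), 0)
      map_add' := fun x y => by ext <;> simp
      map_smul' := fun r x => by ext <;> simp }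
    fun x hx => ⟨Finsupp.single_nonneg.2 (hx.2 n), le_rfl⟩

/-- The projection onto the coordinates at least `N` of the first component. -/
noncomputable def tailFst (N : ℕ) : Lob SumSeq :=
  Lob.ofNonneg
    { toFun := fun x => (x.1.filter (N ≤ ·), 0)
      map_add' := fun x y => by ext <;> simp
      map_smul' := fun r x => by ext <;> simp [Finsupp.filter_smul] }
    fun x hx => ⟨fun i => by
      by_cases h : N ≤ i
      · simpa [h] using hx.1 i
      · simp [h], le_rfl⟩

/-- The projection onto the coordinates at least `N` of the second component. -/
noncomputable def tailSnd (N : ℕ) : Lob SumSeq :=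
  Lob.ofNonneg
    { toFun := fun x => (0, fun i => if N ≤ i then x.2 i else 0)
      map_add' := fun x y => by ext i <;> simp; split_ifs <;> simp
      map_smul' := fun r x => by ext <;> simp }
    fun x hx => ⟨le_rfl, fun i => by
      by_cases h : N ≤ i
      · simpa [h] using hx.2 i
      · simp [h]⟩

theorem sumOp_apply (x : SumSeq) : sumOp x = (0, fun _ => total x.1) := rfl

theorem toUnit_apply (n : ℕ) (x : SumSeq) : toUnit n x = (Finsupp.single n (x.2 0), 0) := rfl

theorem ofCoord_apply (n : ℕ) (x : SumSeq) : ofCoord n x = (Finsupp.single 0 (x.2 n), 0) := rfl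

theorem tailFst_apply (N : ℕ) (x : SumSeq) : tailFst N x = (x.1.filter (N ≤ ·), 0) := rfl

theorem tailSnd_apply (N : ℕ) (x : SumSeq) :
    tailSnd N x = (0, fun i => if N ≤ i then x.2 i else 0) := rfl

theorem tailFst_le {N : ℕ} {x : SumSeq} (hx : 0 ≤ x) : tailFst N x ≤ x := by
  refine ⟨fun i => ?_, hx.2⟩
  by_cases h : N ≤ i
  · simp [tailFst_apply, h]
  · simpa [tailFst_apply, h] using hx.1 i

theorem tailSnd_le {N : ℕ} {x : SumSeq} (hx : 0 ≤ x) : tailSnd N x ≤ x := by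
  refine ⟨hx.1, fun i => ?_⟩
  by_cases h : N ≤ i
  · simp [tailSnd_apply, h]
  · simpa [tailSnd_apply, h] using hx.2 i

theorem exists_tailFst_eq_zero (x : SumSeq) : ∃ N, tailFst N x = 0 := by
  refine ⟨x.1.support.sup id + 1, ?_⟩
  rw [tailFst_apply, Prod.mk_eq_zero]
  refine ⟨(Finsupp.filter_eq_zero_iff _ _).2 fun i hi => ?_, rfl⟩
  by_contra h
  have := Finset.le_sup (f := id) (Finsupp.mem_support_iff.2 h)
  simp only [id] at this
  omega

theorem tailFst_toUnit {N n : ℕ} (h : N ≤ n) (x : SumSeq) :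
    tailFst N (toUnit n x) = toUnit n x := by
  rw [tailFst_apply, toUnit_apply, Finsupp.filter_single_of_pos _ h]

theorem ofCoord_tailSnd {N n : ℕ} (h : N ≤ n) (x : SumSeq) :
    ofCoord n (tailSnd N x) = ofCoord n x := by
  simp [tailSnd_apply, ofCoord_apply, h]

theorem sumOp_toUnit (n : ℕ) (x : SumSeq) : sumOp (toUnit n x) = (0, fun _ => x.2 0) := by
  rw [sumOp_apply, toUnit_apply]
  simp [total]

theorem ofCoord_sumOp (n : ℕ) (x : SumSeq) :
    ofCoord n (sumOp x) = (Finsupp.single 0 (total x.1), 0) := rfl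

/-! ### Unbounded order null sequences of operators -/

/-- Since u - z ≥ 0 dominates its own tail u - tail z, z lies below its tail, and hence below the
tail of y. -/
theorem le_tailFst_of_le {N : ℕ} {z u y : SumSeq} (hu : tailFst N u = u) (hzu : z ≤ u)
    (hzy : z ≤ y) : z ≤ tailFst N y := by
  have h := tailFst_le (N := N) (sub_nonneg.2 hzu)
  rw [map_sub, hu, sub_le_sub_iff_left] at h
  exact h.trans (Lob.mono (Lob.ofNonneg_nonneg _ _) hzy)

theorem uoConv_toUnit_apply_nonneg {x : SumSeq} (hx : 0 ≤ x) :
    UOConv ℕ (fun n => toUnit n x) 0 := by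
  refine uoConv_zero_of_forall_le (fun n => Lob.ofNonneg_nonneg _ _ x hx)
    (fun y N => tailFst N y) (fun y _ N n hn => ?_) fun y _ w hw => ?_
  · exact le_tailFst_of_le (tailFst_toUnit hn x) inf_le_left inf_le_right
  · obtain ⟨N, hN⟩ := exists_tailFst_eq_zero y
    exact (hw N).trans hN.le

theorem uoConv_toUnit : UOConv ℕ toUnit 0 := by
  refine uoConv_zero_of_forall_le (fun n => Lob.ofNonneg_nonneg _ _)
    (fun Y N => tailFst N * Y) (fun Y _ N n hn x hx => ?_) fun Y _ W hW x hx => ?_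
  · have h₁ : toUnit n ⊓ Y ≤ toUnit n := inf_le_left
    have h₂ : toUnit n ⊓ Y ≤ Y := inf_le_right
    exact le_tailFst_of_le (tailFst_toUnit hn x) (h₁ x hx) (h₂ x hx)
  · obtain ⟨N, hN⟩ := exists_tailFst_eq_zero (Y x)
    exact (hW N x hx).trans hN.le

theorem uoConv_ofCoord : UOConv ℕ ofCoord 0 := by
  refine uoConv_zero_of_forall_le (fun n => Lob.ofNonneg_nonneg _ _)
    (fun Y N => Y * tailSnd N) (fun Y _ N n hn x hx => ?_) fun Y hY W hW x hx => ?_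
  · have h₁ : ofCoord n ⊓ Y ≤ ofCoord n := inf_le_left
    have h₂ : ofCoord n ⊓ Y ≤ Y := inf_le_right
    -- `ofCoord n` kills x minus its tail, so the infimum is at most 0 there, and its value at x is
    -- at most its value at the tail.
    have h₃ := h₁ _ (sub_nonneg.2 (tailSnd_le (N := N) hx))
    rw [map_sub, map_sub, ofCoord_tailSnd hn, sub_self, sub_nonpos] at h₃
    exact h₃.trans (h₂ _ (Lob.ofNonneg_nonneg _ _ x hx))
  -- The second factor contains all sequences, so the weighted sequence (i + 1) x i is available.
  -- The tail from n on is at most (n + 1)⁻¹ times it, so positivity of Y suffices.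
  · refine DedekindComplete.hasArchimedeanOrder _ (Y (0, fun i => ((i : ℝ) + 1) * x.2 i))
      fun n => (hW n x hx).trans ?_
    rw [Lob.mul_apply, ← map_smul]
    refine Lob.mono hY ⟨by simp [tailSnd_apply], fun i => ?_⟩
    have hi : 0 ≤ x.2 i := hx.2 i
    have hn : (0 : ℝ) < (n : ℝ) + 1 := by positivity
    by_cases h : n ≤ i
    · have h' : (n : ℝ) ≤ i := by exact_mod_cast h
      simp only [tailSnd_apply, h, if_true, Prod.smul_snd, Pi.smul_apply, smul_eq_mul]
      rw [← div_eq_inv_mul, le_div_iff₀ hn, mul_comm]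
      gcongr
    · simp only [tailSnd_apply, h, if_false, Prod.smul_snd, Pi.smul_apply, smul_eq_mul]
      positivity

theorem suoConv_toUnit : SUOConv ℕ toUnit 0 := by
  intro x
  have h := uoConv_toUnit_apply_nonneg (abs_nonneg x)
  intro y hy
  obtain ⟨B, i₁, i₂, i₃, z, hz, hz₀, hxz⟩ := h y hy
  refine ⟨B, i₁, i₂, i₃, z, hz, hz₀, fun b => ?_⟩
  obtain ⟨a₀, ha₀⟩ := hxz b
  refine ⟨a₀, fun a ha => le_trans ?_ (ha₀ a ha)⟩
  have hT : 0 ≤ toUnit a := Lob.ofNonneg_nonneg _ _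
  have h₁ : |toUnit a x| ≤ toUnit a |x| := by
    rw [abs_le', ← map_neg]
    exact ⟨Lob.mono hT (le_abs_self x), Lob.mono hT (neg_le_abs x)⟩
  simp only [Lob.zero_apply, sub_zero, zero_sub, abs_neg]
  rw [abs_of_nonneg (le_inf (abs_nonneg _) hy), abs_of_nonneg (le_inf (abs_nonneg _) hy)]
  exact inf_le_inf_right _ (h₁.trans (le_abs_self _))

/-- Beyond `b₀` all supports lie in the finite support of `y b₀`, where finitely many coordinates
can be made small simultaneously. -/
theorem total_le_zero_of_isGLB {B : Type*} [Preorder B] [IsDirectedOrder B] [Nonempty B]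
    {y : B → SumSeq} (hy : Antitone y) (hy₀ : IsGLB (Set.range y) 0) {c : ℝ}
    (hc : ∀ b, c ≤ total (y b).1) : c ≤ 0 := by
  classical
  obtain ⟨b₀⟩ := ‹Nonempty B›
  have hpos : ∀ b, 0 ≤ y b := fun b => hy₀.1 ⟨b, rfl⟩
  by_contra! hc₀
  set F := (y b₀).1.support
  -- The added 1 makes |F| ε strictly smaller than c and covers empty F.
  set ε := c / (F.card + 1)
  have hε : 0 < ε := by positivity
  have hex : ∀ i, ∃ b, (y b).1 i < ε := by
    by_contra! h
    obtain ⟨i, hi⟩ := h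
    -- If coordinate i never dropped below ε, then ε e i would be a positive lower bound of the net.
    have h₁ : ((Finsupp.single i ε, 0) : SumSeq) ≤ 0 := by
      refine hy₀.2 ?_
      rintro _ ⟨b, rfl⟩
      refine ⟨fun j => ?_, (hpos b).2⟩
      rcases eq_or_ne i j with rfl | hij
      · simpa using hi b
      · simpa [Finsupp.single_apply, hij] using (hpos b).1 j
    have := h₁.1 i
    simp only [Finsupp.single_eq_same] at this
    exact absurd hε (not_lt.2 this)
  choose β hβ using hex
  obtain ⟨b, hb⟩ := Finset.exists_le (insert b₀ (F.image β))
  have hb₀ : b₀ ≤ b := hb _ (Finset.mem_insert_self _ _)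
  have hsub : (y b).1.support ⊆ F := by
    intro i hi
    rw [Finsupp.mem_support_iff] at hi ⊢
    intro h
    exact hi (le_antisymm (((hy hb₀).1 i).trans h.le) ((hpos b).1 i))
  have h₁ : total (y b).1 ≤ F.card * ε := by
    rw [total_apply, Finsupp.sum_of_support_subset _ hsub _ (by simp), ← nsmul_eq_mul]
    refine Finset.sum_le_card_nsmul _ _ _ fun i hi => ?_
    exact ((hy (hb _ (Finset.mem_insert_of_mem (Finset.mem_image_of_mem β hi)))).1 i).trans
      (hβ i).le
  have h₂ : (F.card + 1) * ε = c := by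
    simp only [ε]
    field_simp
  have := hc b
  linarith

theorem isOrderContinuous_sumOp : IsOrderContinuous sumOp := by
  rintro ι _ _ _ x ⟨B, i₁, i₂, i₃, y, hy, hy₀, hxy⟩
  have hT : 0 ≤ sumOp := Lob.ofNonneg_nonneg _ _
  refine ⟨B, i₁, i₂, i₃, fun b => sumOp (y b), fun b c hbc => Lob.mono hT (hy hbc), ⟨?_, ?_⟩,
    fun b => ?_⟩
  · rintro _ ⟨b, rfl⟩
    exact hT _ (hy₀.1 ⟨b, rfl⟩)
  · intro w hw
    refine ⟨(hw ⟨Classical.arbitrary B, rfl⟩).1, fun i => ?_⟩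
    exact total_le_zero_of_isGLB hy hy₀ fun b => (hw ⟨b, rfl⟩).2 i
  · obtain ⟨a₀, ha₀⟩ := hxy b
    refine ⟨a₀, fun a ha => ?_⟩
    have h₁ := ha₀ a ha
    rw [zero_sub, abs_neg] at h₁ ⊢
    rw [abs_le', ← map_neg]
    exact ⟨Lob.mono hT ((le_abs_self _).trans h₁), Lob.mono hT ((neg_le_abs _).trans h₁)⟩

/-! ### Failure of the three continuity properties -/

theorem not_continuousWrt_rho :
    ¬ ContinuousWrt (UOConv.{0} (E := Lob SumSeq)) (UOConv.{0} (E := Lob SumSeq))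
      (Lob.rho sumOp) := by
  intro h
  have h₁ := h ℕ ofCoord 0 uoConv_ofCoord
  -- All coordinates of the constant sequence produced by `sumOp` agree, so the products do not
  -- depend on n.
  have h₂ : (fun n => Lob.rho sumOp (ofCoord n)) = fun _ => ofCoord 0 * sumOp := rfl
  rw [h₂, show Lob.rho sumOp 0 = 0 from zero_mul sumOp] at h₁
  refine not_uoConv_const_zero (Lob.mul_nonneg (Lob.ofNonneg_nonneg _ _)
    (Lob.ofNonneg_nonneg _ _)) (fun h₀ => ?_) h₁
  have h₃ := congrArg (fun S : Lob SumSeq => (S (Finsupp.single 0 1, 0)).1 0) h₀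
  simp [ofCoord_sumOp, total] at h₃

theorem not_continuousWrt_lam :
    ¬ ContinuousWrt (UOConv.{0} (E := Lob SumSeq)) (UOConv.{0} (E := Lob SumSeq))
      (Lob.lam sumOp) := by
  intro h
  have h₁ := h ℕ toUnit 0 uoConv_toUnit
  have h₂ : (fun n => Lob.lam sumOp (toUnit n)) = fun _ => sumOp * toUnit 0 :=
    funext fun n => Lob.ext fun x => (sumOp_toUnit n x).trans (sumOp_toUnit 0 x).symm
  rw [h₂, show Lob.lam sumOp 0 = 0 from mul_zero sumOp] at h₁
  refine not_uoConv_const_zero (Lob.mul_nonneg (Lob.ofNonneg_nonneg _ _)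
    (Lob.ofNonneg_nonneg _ _)) (fun h₀ => ?_) h₁
  have h₃ := congrArg (fun S : Lob SumSeq => (S (0, 1)).2 0) h₀
  simp [sumOp_toUnit] at h₃

theorem not_continuousWrt_lam_suoConv :
    ¬ ContinuousWrt (SUOConv.{0} (E := SumSeq)) (SUOConv.{0} (E := SumSeq))
      (Lob.lam sumOp) := by
  intro h
  have h₁ := h ℕ toUnit 0 suoConv_toUnit (0, 1)
  have h₂ : (fun n => Lob.lam sumOp (toUnit n) ((0, 1) : SumSeq)) = fun _ => ((0, 1) : SumSeq) :=
    funext fun n => sumOp_toUnit n (0, 1)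
  rw [h₂, show Lob.lam sumOp 0 = 0 from mul_zero sumOp] at h₁
  have h₀ : (0 : SumSeq) ≤ (0, 1) := ⟨le_rfl, fun _ => zero_le_one⟩
  refine not_uoConv_const_zero h₀ (fun h₀ => ?_) h₁
  have h₃ := congrArg (fun z : SumSeq => z.2 0) h₀
  simp at h₃

end SumSeq

theorem mainTheorem4 :
    -- the positive results, for nets indexed by types in an arbitrary universe `v`
    (∀ (E : Type u) [AddCommGroup E] [Lattice E] [IsOrderedAddMonoid E] [Module ℝ E]
        [IsOrderedModule ℝ E] [DedekindComplete E],
      (∀ T : Lob E, IsOrthomorphism T →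
        ContinuousWrt (UOConv.{v} (E := Lob E)) (UOConv.{v} (E := Lob E)) (Lob.rho T)) ∧
      (∀ T : Lob E, IsOrthomorphism T →
        ContinuousWrt (UOConv.{v} (E := Lob E)) (UOConv.{v} (E := Lob E)) (Lob.lam T)) ∧
      (∀ T : Lob E,
        ContinuousWrt (SUOConv.{v} (E := E)) (SUOConv.{v} (E := E)) (Lob.rho T)) ∧
      (∀ T : Lob E, IsOrthomorphism T →
        ContinuousWrt (SUOConv.{v} (E := E)) (SUOConv.{v} (E := E)) (Lob.lam T))) ∧
    -- "orthomorphism" cannot be weakened to "order continuous" in any of the three cases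
    (∃ (E : Type) (_ : AddCommGroup E) (_ : Lattice E) (_ : IsOrderedAddMonoid E)
        (_ : Module ℝ E) (_ : IsOrderedModule ℝ E) (_ : DedekindComplete E) (T : Lob E),
      IsOrderContinuous T ∧
      ¬ ContinuousWrt (UOConv.{0} (E := Lob E)) (UOConv.{0} (E := Lob E)) (Lob.rho T) ∧
      ¬ ContinuousWrt (UOConv.{0} (E := Lob E)) (UOConv.{0} (E := Lob E)) (Lob.lam T) ∧
      ¬ ContinuousWrt (SUOConv.{0} (E := E)) (SUOConv.{0} (E := E)) (Lob.lam T)) := by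
  refine ⟨fun E _ _ _ _ _ _ => ⟨fun T hT => hT.continuousWrt_rho, fun T hT => hT.continuousWrt_lam,
    fun T ι _ _ _ S S₀ h x => h (T x),
    fun T hT ι _ _ _ S S₀ h x => hT.continuousWrt_uoConv ι _ _ (h x)⟩, ?_⟩
  exact ⟨SumSeq, inferInstance, inferInstance, inferInstance, inferInstance, inferInstance,
    inferInstance, SumSeq.sumOp, SumSeq.isOrderContinuous_sumOp, SumSeq.not_continuousWrt_rho,
    SumSeq.not_continuousWrt_lam, SumSeq.not_continuousWrt_lam_suoConv⟩
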